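/- Let $\mathsf{C}$ be a strict symmetric monoidal category with tensor product $\otimes$, unit object $K$ and symmetry $c$; for an object $P$ and a morphism $f$, write $P\otimes f=\mathrm{id}_P\otimes f$ and $f\otimes P=f\otimes \mathrm{id}_P$. A Hopf algebra in $\mathsf{C}$ is a tuple $X=(X,\eta_X,\mu_X,\varepsilon_X,\delta_X,\lambda_X)$ (unit, product, counit, coproduct, antipode) satisfying the usual axioms. A Hopf brace $(X_1,X_2)$ in $\mathsf{C}$ consists of two Hopf algebras $X_i=(X,\eta_X^i,\mu_X^i,\varepsilon_X,\delta_X,\lambda_X^i)$, $i=1,2$, on the same object with the same underlying coalgebra, such that $$\mu_X^2\circ(X\otimes\mu_X^1)=\mu_X^1\circ(\mu_X^2\otimes\Gamma_{X_1})\circ(X\otimes c_{X,X}\otimes X)\circ(\delta_X\otimes X\otimes X),$$ where $\Gamma_{X_1}=\mu_X^1\circ(\lambda_X^1\otimes\mu_X^2)\circ(\delta_X\otimes X)$. It is cocommutative if $c_{X,X}\circ\delta_X=\delta_X$. For Hopf algebras $A,H$ in $\mathsf{C}$ and morphisms $\varphi_A\colon H\otimes A\to A$, $\phi_H\colon H\otimes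 A\to H$, put $$\Psi=(\varphi_A\otimes\phi_H)\circ(H\otimes c_{H,A}\otimes A)\circ(\delta_H\otimes\delta_A).$$ The tuple $(A,H,\varphi_A,\phi_H)$ is a matched pair of Hopf algebras if $(A,\varphi_A)$ is a left $H$-module coalgebra, $(H,\phi_H)$ is a right $A$-module coalgebra, and $$\varphi_A\circ(H\otimes\eta_A)=\varepsilon_H\otimes\eta_A,\qquad \phi_H\circ(\eta_H\otimes A)=\eta_H\otimes\varepsilon_A,$$ $$\varphi_A\circ(H\otimes\mu_A)=\mu_A\circ(A\otimes\varphi_A)\circ(\Psi\otimes A),\qquad \phi_H\circ(\mu_H\otimes A)=\mu_H\circ(\phi_H\otimes H)\circ(H\otimes\Psi),$$ $$c_{A,H}\circ\Psi=(\phi_H\otimes\varphi_A)\circ(H\otimes c_{H,A}\otimes A)\circ(\delta_H\otimes\delta_A).$$ The bicrossed product $A\bowtie H$ is then the Hopf algebra on $A\otimes H$ with the unit, counit and coproduct of the tensor product Hopf algebra $A\otimes H$, with product $(\mu_A\otimes\mu_H)\circ(A\otimes\Psi\otimes H)$ and antipode $\Psi\circ(\lambda_H\otimes\lambda_A)\circ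 c_{A,H}$. **Theorem.** Let $(A_1,A_2)$ be a Hopf brace and $(H_1,H_2)$ a cocommutative Hopf brace in $\mathsf{C}$, with underlying objects $A$ and $H$, and let $(A_2,H_2,\varphi_A,\phi_H)$ be a matched pair of Hopf algebras. Then $(A_1\otimes H_1,\,A_2\bowtie H_2)$, where $A_1\otimes H_1$ is the tensor product Hopf algebra, is a Hopf brace in $\mathsf{C}$ if and only if both of the following hold: (E1) $\mu_A^1\circ(\varphi_A\otimes\varphi_A)\circ(H\otimes c_{H,A}\otimes A)\circ(\delta_H\otimes A\otimes A)=\varphi_A\circ(H\otimes\mu_A^1)$; (E2) $$\mu_H^1\circ(\mu_H^2\otimes\Omega)\circ(H\otimes c_{H,H}\otimes A\otimes H)\circ\big(((\phi_H\otimes H)\circ(H\otimes c_{H,A})\circ(\delta_H\otimes A))\otimes H\otimes A\otimes H\big)$$ $$=\mu_H^2\circ\big((\phi_H\circ(H\otimes\mu_A^1))\otimes\mu_H^1\big)\circ(H\otimes A\otimes c_{H,A}\otimes H),$$ where $$\Omega=\mu_H^1\circ\big(\lambda_H^1\otimes(\mu_H^2\circ(\phi_H\otimes H))\big)\circ(\delta_H\otimes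 A\otimes H).$$ -/

import Mathlib

open CategoryTheory MonoidalCategory

universe v u

/-- The tuple `(X, η, μ, ε, δ, S)` of structure morphisms of a would-be Hopf algebra on an object
`X`.  The laws are imposed by `HopfTuple.IsHopfAlgebra`. -/
@[ext]
structure HopfTuple {C : Type u} [Category.{v} C] [MonoidalCategory C] (X : C) where
  /-- unit -/
  one : 𝟙_ C ⟶ X
  /-- product -/
  mul : X ⊗ X ⟶ X
  /-- counit -/
  counit : X ⟶ 𝟙_ C
  /-- coproduct -/
  comul : X ⟶ X ⊗ X
  /-- antipode -/
  antipode : X ⟶ X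

namespace HopfTuple

section Defs

variable {C : Type u} [Category.{v} C] [MonoidalCategory C] [SymmetricCategory C] {A H : C}

/-- The tuple of structure morphisms of a Hopf monoid object. -/
def ofHopfObj {X : C} (h : HopfObj X) : HopfTuple X where
  one := h.one
  mul := h.mul
  counit := h.counit
  comul := h.comul
  antipode := h.antipode

/-- The tuple is a Hopf algebra in `C`, i.e. it is the tuple of structure morphisms of a Hopf
monoid object. -/
def IsHopfAlgebra {X : C} (T : HopfTuple X) : Prop :=
  ∃ h : HopfObj X, ofHopfObj h = T

/-- The coalgebra underlying the tuple is cocommutative. -/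
def IsCocommutative {X : C} (T : HopfTuple X) : Prop :=
  T.comul ≫ (β_ X X).hom = T.comul

/-- `Γ = μ¹ ∘ (S¹ ⊗ μ²) ∘ (δ ⊗ X) : X ⊗ X ⟶ X`. -/
def gamma {X : C} (T₁ T₂ : HopfTuple X) : X ⊗ X ⟶ X :=
  T₁.comul ▷ X ≫ (α_ X X X).hom ≫ (T₁.antipode ⊗ₘ T₂.mul) ≫ T₁.mul

/-- The pair `(T₁, T₂)` is a Hopf brace: two Hopf algebras on `X` with the same underlying
coalgebra such that `μ² ∘ (X ⊗ μ¹) = μ¹ ∘ (μ² ⊗ Γ) ∘ (X ⊗ c ⊗ X) ∘ (δ ⊗ X ⊗ X)`. -/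
structure IsHopfBrace {X : C} (T₁ T₂ : HopfTuple X) : Prop where
  isHopfAlgebra₁ : T₁.IsHopfAlgebra
  isHopfAlgebra₂ : T₂.IsHopfAlgebra
  counit_eq : T₁.counit = T₂.counit
  comul_eq : T₁.comul = T₂.comul
  compat : X ◁ T₁.mul ≫ T₂.mul =
    T₁.comul ▷ (X ⊗ X) ≫ tensorμ X X X X ≫ (T₂.mul ⊗ₘ gamma T₁ T₂) ≫ T₁.mul

/-- A Hopf brace whose underlying coalgebra is cocommutative. -/
structure IsCocommutativeHopfBrace {X : C} (T₁ T₂ : HopfTuple X) : Prop extends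
    IsHopfBrace T₁ T₂ where
  cocomm : T₁.IsCocommutative

/-- `φ : H ⊗ A ⟶ A` makes `A` a left module coalgebra over the Hopf algebra `TH` on `H`
(only the coalgebra part of `TA` matters). -/
structure IsLeftModuleCoalgebra (TH : HopfTuple H) (TA : HopfTuple A) (φ : H ⊗ A ⟶ A) :
    Prop where
  one_act : TH.one ▷ A ≫ φ = (λ_ A).hom
  mul_act : TH.mul ▷ A ≫ φ = (α_ H H A).hom ≫ H ◁ φ ≫ φ
  act_counit : φ ≫ TA.counit = (TH.counit ⊗ₘ TA.counit) ≫ (λ_ (𝟙_ C)).hom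
  act_comul : φ ≫ TA.comul = (TH.comul ⊗ₘ TA.comul) ≫ tensorμ H H A A ≫ (φ ⊗ₘ φ)

/-- `ϕ : H ⊗ A ⟶ H` makes `H` a right module coalgebra over the Hopf algebra `TA` on `A`
(only the coalgebra part of `TH` matters). -/
structure IsRightModuleCoalgebra (TA : HopfTuple A) (TH : HopfTuple H) (ϕ : H ⊗ A ⟶ H) :
    Prop where
  act_one : H ◁ TA.one ≫ ϕ = (ρ_ H).hom
  act_mul : H ◁ TA.mul ≫ ϕ = (α_ H A A).inv ≫ ϕ ▷ A ≫ ϕ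
  act_counit : ϕ ≫ TH.counit = (TH.counit ⊗ₘ TA.counit) ≫ (λ_ (𝟙_ C)).hom
  act_comul : ϕ ≫ TH.comul = (TH.comul ⊗ₘ TA.comul) ≫ tensorμ H H A A ≫ (ϕ ⊗ₘ ϕ)

/-- `Ψ = (φ ⊗ ϕ) ∘ (H ⊗ c ⊗ A) ∘ (δ ⊗ δ) : H ⊗ A ⟶ A ⊗ H`. -/
def psi (TA : HopfTuple A) (TH : HopfTuple H) (φ : H ⊗ A ⟶ A) (ϕ : H ⊗ A ⟶ H) :
    H ⊗ A ⟶ A ⊗ H :=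
  (TH.comul ⊗ₘ TA.comul) ≫ tensorμ H H A A ≫ (φ ⊗ₘ ϕ)

/-- `(A, H, φ, ϕ)` is a matched pair of Hopf algebras. -/
structure IsMatchedPair (TA : HopfTuple A) (TH : HopfTuple H) (φ : H ⊗ A ⟶ A)
    (ϕ : H ⊗ A ⟶ H) : Prop where
  isHopfAlgebra_left : TA.IsHopfAlgebra
  isHopfAlgebra_right : TH.IsHopfAlgebra
  left_module : IsLeftModuleCoalgebra TH TA φ
  right_module : IsRightModuleCoalgebra TA TH ϕ
  act_one : H ◁ TA.one ≫ φ = TH.counit ▷ 𝟙_ C ≫ (λ_ (𝟙_ C)).hom ≫ TA.one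
  one_act : TH.one ▷ A ≫ ϕ = 𝟙_ C ◁ TA.counit ≫ (λ_ (𝟙_ C)).hom ≫ TH.one
  act_mul : H ◁ TA.mul ≫ φ =
    (α_ H A A).inv ≫ psi TA TH φ ϕ ▷ A ≫ (α_ A H A).hom ≫ A ◁ φ ≫ TA.mul
  mul_act : TH.mul ▷ A ≫ ϕ =
    (α_ H H A).hom ≫ H ◁ psi TA TH φ ϕ ≫ (α_ H A H).inv ≫ ϕ ▷ H ≫ TH.mul
  psi_braiding : psi TA TH φ ϕ ≫ (β_ A H).hom =
    (TH.comul ⊗ₘ TA.comul) ≫ tensorμ H H A A ≫ (ϕ ⊗ₘ φ)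

/-- The tensor product Hopf algebra `A ⊗ H`. -/
def tensor (TA : HopfTuple A) (TH : HopfTuple H) : HopfTuple (A ⊗ H) where
  one := (λ_ (𝟙_ C)).inv ≫ (TA.one ⊗ₘ TH.one)
  mul := tensorμ A H A H ≫ (TA.mul ⊗ₘ TH.mul)
  counit := (TA.counit ⊗ₘ TH.counit) ≫ (λ_ (𝟙_ C)).hom
  comul := (TA.comul ⊗ₘ TH.comul) ≫ tensorμ A A H H
  antipode := TA.antipode ⊗ₘ TH.antipode

/-- The bicrossed product `A ⋈ H`: the unit, counit and coproduct are those of `A ⊗ H`, while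
`μ = (μ_A ⊗ μ_H) ∘ (A ⊗ Ψ ⊗ H)` and `S = Ψ ∘ (S_H ⊗ S_A) ∘ c`. -/
def bicrossed (TA : HopfTuple A) (TH : HopfTuple H) (φ : H ⊗ A ⟶ A) (ϕ : H ⊗ A ⟶ H) :
    HopfTuple (A ⊗ H) where
  one := (tensor TA TH).one
  mul := (α_ A H (A ⊗ H)).hom ≫
    A ◁ ((α_ H A H).inv ≫ psi TA TH φ ϕ ▷ H ≫ (α_ A H H).hom) ≫
    (α_ A A (H ⊗ H)).inv ≫ (TA.mul ⊗ₘ TH.mul)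
  counit := (tensor TA TH).counit
  comul := (tensor TA TH).comul
  antipode := (β_ A H).hom ≫ (TH.antipode ⊗ₘ TA.antipode) ≫ psi TA TH φ ϕ

/-- `Ω = μ¹ ∘ (S¹ ⊗ (μ² ∘ (ϕ ⊗ H))) ∘ (δ ⊗ A ⊗ H) : H ⊗ A ⊗ H ⟶ H`. -/
def omega (H₁ H₂ : HopfTuple H) (ϕ : H ⊗ A ⟶ H) : H ⊗ A ⊗ H ⟶ H :=
  H₁.comul ▷ (A ⊗ H) ≫ (α_ H H (A ⊗ H)).hom ≫
    (H₁.antipode ⊗ₘ ((α_ H A H).inv ≫ ϕ ▷ H ≫ H₂.mul)) ≫ H₁.mul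

/-- `μ_A¹ ∘ (φ ⊗ φ) ∘ (H ⊗ c ⊗ A) ∘ (δ ⊗ A ⊗ A) = φ ∘ (H ⊗ μ_A¹)`. -/
def ConditionE1 (A₁ : HopfTuple A) (H₁ : HopfTuple H) (φ : H ⊗ A ⟶ A) : Prop :=
  H₁.comul ▷ (A ⊗ A) ≫ tensorμ H H A A ≫ (φ ⊗ₘ φ) ≫ A₁.mul = H ◁ A₁.mul ≫ φ

/-- The equality
`μ_H¹ ∘ (μ_H² ⊗ Ω) ∘ (H ⊗ c ⊗ A ⊗ H) ∘ (((ϕ ⊗ H) ∘ (H ⊗ c) ∘ (δ ⊗ A)) ⊗ H ⊗ A ⊗ H)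
  = μ_H² ∘ ((ϕ ∘ (H ⊗ μ_A¹)) ⊗ μ_H¹) ∘ (H ⊗ A ⊗ c ⊗ H)`
of morphisms `H ⊗ A ⊗ H ⊗ A ⊗ H ⟶ H`. -/
def ConditionE2 (A₁ : HopfTuple A) (H₁ H₂ : HopfTuple H) (ϕ : H ⊗ A ⟶ H) : Prop :=
  (α_ H A (H ⊗ A ⊗ H)).inv ≫
      (H₁.comul ▷ A ≫ (α_ H H A).hom ≫ H ◁ (β_ H A).hom ≫ (α_ H A H).inv ≫ ϕ ▷ H) ▷
        (H ⊗ A ⊗ H) ≫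
      tensorμ H H H (A ⊗ H) ≫ (H₂.mul ⊗ₘ omega H₁ H₂ ϕ) ≫ H₁.mul =
    H ◁ A ◁ ((α_ H A H).inv ≫ (β_ H A).hom ▷ H ≫ (α_ A H H).hom) ≫
      H ◁ (α_ A A (H ⊗ H)).inv ≫ (α_ H (A ⊗ A) (H ⊗ H)).inv ≫
      ((H ◁ A₁.mul ≫ ϕ) ⊗ₘ H₁.mul) ≫ H₂.mul

end Defs

end HopfTuple

/-! The computation uses generalized elements: morphisms `T ⟶ X` out of an arbitrary comonoid `T`,
combined by the convolution pairing `pair`. Along comonoid morphisms a coproduct becomes a repeated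
variable, so string diagrams become equations between products. The two projections of `X ⊗ Y` pair
to the identity (`pair_projections`), so identities of morphisms out of a tensor product may be
checked on such elements (`ext_projections`). As `T` need not be cocommutative, every exchange of
factors requires `Commutes`, which holds for the projections to distinct tensor factors.

Write `h ▷ b`, `h ◁ b` for the two actions. On elements `(a, h)`, `(b, g)`, `(c, k)`, the two sides
of the brace compatibility have `A`-components `a ·₂ (h ▷ (b ·₁ c))` and, by the brace identity in
`A`, `a ·₂ ((h ▷ b) ·₁ (h ▷ c))`; their `H`-components are the two sides of (E2)
(`pair_mul_bicrossed`, `pair_bicrossed_gamma`). Hence (E1) and (E2) suffice. Conversely, `a = 1`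
followed by the counits isolates each condition. Cocommutativity of `H` permits exchanging the
copies of `h` spread over both components.

That the bicrossed product is a Hopf algebra (`laws_bicrossed`) rests on the factorization `Ψ(h, a)
= (1, h)(a, 1)`. -/

namespace HopfTuple

/-! ### Generalized elements: convolution pairing and commutation -/

section Elements

open scoped ComonObj

variable {C : Type u} [Category.{v} C] [MonoidalCategory C] {S T W X Y Z X' Y' : C}

/-- The convolution pairing `(f ⊗ g) ∘ δ` of two morphisms out of a comonoid. -/
def pair [ComonObj T] (f : T ⟶ X) (g : T ⟶ Y) : T ⟶ X ⊗ Y :=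
  Δ[T] ≫ (f ⊗ₘ g)

section Monoidal

variable [ComonObj T]

@[simp]
lemma pair_tensorHom (f : T ⟶ X) (g : T ⟶ Y) (p : X ⟶ X') (q : Y ⟶ Y') :
    pair f g ≫ (p ⊗ₘ q) = pair (f ≫ p) (g ≫ q) := by
  simp [pair]

@[simp]
lemma pair_tensorHom_assoc (f : T ⟶ X) (g : T ⟶ Y) (p : X ⟶ X') (q : Y ⟶ Y')
    (k : X' ⊗ Y' ⟶ Z) : pair f g ≫ (p ⊗ₘ q) ≫ k = pair (f ≫ p) (g ≫ q) ≫ k := by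
  rw [← pair_tensorHom, Category.assoc]

@[simp]
lemma pair_whiskerRight (f : T ⟶ X) (g : T ⟶ Y) (p : X ⟶ X') :
    pair f g ≫ p ▷ Y = pair (f ≫ p) g := by
  rw [← tensorHom_id, pair_tensorHom, Category.comp_id]

@[simp]
lemma pair_whiskerRight_assoc (f : T ⟶ X) (g : T ⟶ Y) (p : X ⟶ X') (k : X' ⊗ Y ⟶ Z) :
    pair f g ≫ p ▷ Y ≫ k = pair (f ≫ p) g ≫ k := by
  rw [← pair_whiskerRight, Category.assoc]

@[simp]
lemma pair_whiskerLeft (f : T ⟶ X) (g : T ⟶ Y) (q : Y ⟶ Y') :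
    pair f g ≫ X ◁ q = pair f (g ≫ q) := by
  rw [← id_tensorHom, pair_tensorHom, Category.comp_id]

@[simp]
lemma pair_whiskerLeft_assoc (f : T ⟶ X) (g : T ⟶ Y) (q : Y ⟶ Y') (k : X ⊗ Y' ⟶ Z) :
    pair f g ≫ X ◁ q ≫ k = pair f (g ≫ q) ≫ k := by
  rw [← pair_whiskerLeft, Category.assoc]

-- This is coassociativity of `T`.
@[simp]
lemma pair_associator_hom (f : T ⟶ X) (g : T ⟶ Y) (h : T ⟶ Z) :
    pair (pair f g) h ≫ (α_ X Y Z).hom = pair f (pair g h) := by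
  have h₁ : pair (pair f g) h =
      Δ[T] ≫ Δ[T] ▷ T ≫ ((f ⊗ₘ g) ⊗ₘ h) := by
    simp only [pair, ← tensorHom_id, MonoidalCategory.tensorHom_comp_tensorHom, Category.id_comp]
  have h₂ : pair f (pair g h) = Δ[T] ≫ T ◁ Δ[T] ≫ (f ⊗ₘ (g ⊗ₘ h)) := by
    simp only [pair, ← id_tensorHom, MonoidalCategory.tensorHom_comp_tensorHom, Category.id_comp]
  rw [h₁, h₂, ComonObj.comul_assoc_assoc]
  simp only [Category.assoc, associator_naturality]

@[simp]
lemma pair_associator_hom_assoc (f : T ⟶ X) (g : T ⟶ Y) (h : T ⟶ Z) (k : X ⊗ Y ⊗ Z ⟶ W) :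
    pair (pair f g) h ≫ (α_ X Y Z).hom ≫ k = pair f (pair g h) ≫ k := by
  rw [← pair_associator_hom, Category.assoc]

@[simp]
lemma pair_associator_inv (f : T ⟶ X) (g : T ⟶ Y) (h : T ⟶ Z) :
    pair f (pair g h) ≫ (α_ X Y Z).inv = pair (pair f g) h := by
  rw [← pair_associator_hom, Category.assoc, Iso.hom_inv_id, Category.comp_id]

@[simp]
lemma pair_associator_inv_assoc (f : T ⟶ X) (g : T ⟶ Y) (h : T ⟶ Z)
    (k : (X ⊗ Y) ⊗ Z ⟶ W) :
    pair f (pair g h) ≫ (α_ X Y Z).inv ≫ k = pair (pair f g) h ≫ k := by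
  rw [← pair_associator_inv, Category.assoc]

lemma pair_counit_left (f : T ⟶ X) : pair ε[T] f = f ≫ (λ_ X).inv := by
  rw [pair, MonoidalCategory.tensorHom_def, ComonObj.counit_comul_assoc, leftUnitor_inv_naturality]

lemma pair_counit_right (f : T ⟶ X) : pair f ε[T] = f ≫ (ρ_ X).inv := by
  rw [pair, MonoidalCategory.tensorHom_def', ComonObj.comul_counit_assoc, rightUnitor_inv_naturality]

@[simp]
lemma pair_leftUnitor (f : T ⟶ X) : pair ε[T] f ≫ (λ_ X).hom = f := by
  simp [pair_counit_left]

@[simp]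
lemma pair_leftUnitor_assoc (f : T ⟶ X) (k : X ⟶ Y) :
    pair ε[T] f ≫ (λ_ X).hom ≫ k = f ≫ k := by
  simp [pair_counit_left]

@[simp]
lemma pair_rightUnitor (f : T ⟶ X) : pair f ε[T] ≫ (ρ_ X).hom = f := by
  simp [pair_counit_right]

@[simp]
lemma pair_rightUnitor_assoc (f : T ⟶ X) (k : X ⟶ Y) :
    pair f ε[T] ≫ (ρ_ X).hom ≫ k = f ≫ k := by
  simp [pair_counit_right]

lemma pair_point_left (p : 𝟙_ C ⟶ X) (f : T ⟶ Y) :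
    pair (ε[T] ≫ p) f = f ≫ (λ_ Y).inv ≫ p ▷ Y := by
  rw [← pair_whiskerRight, pair_counit_left, Category.assoc]

lemma pair_point_right (f : T ⟶ X) (p : 𝟙_ C ⟶ Y) :
    pair f (ε[T] ≫ p) = f ≫ (ρ_ X).inv ≫ X ◁ p := by
  rw [← pair_whiskerLeft, pair_counit_right, Category.assoc]

/-- A comonoid morphism can be copied; this is what lets repeated variables replace coproducts. -/
lemma comp_pair [ComonObj S] (w : S ⟶ T) [IsComonHom w] (f : T ⟶ X) (g : T ⟶ Y) :
    w ≫ pair f g = pair (w ≫ f) (w ≫ g) := by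
  simp [pair]

lemma comp_comul [ComonObj X] (x : T ⟶ X) [IsComonHom x] : x ≫ Δ[X] = pair x x := by
  simp [pair]

end Monoidal

section Braided

variable [SymmetricCategory C] [ComonObj T]

/-- Two morphisms out of a comonoid commute if the braiding exchanges the two factors of their
pairing. -/
class Commutes (f : T ⟶ X) (g : T ⟶ Y) : Prop where
  pair_braiding' : pair f g ≫ (β_ X Y).hom = pair g f

@[simp]
lemma pair_braiding (f : T ⟶ X) (g : T ⟶ Y) [Commutes f g] :
    pair f g ≫ (β_ X Y).hom = pair g f :=
  Commutes.pair_braiding'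

@[simp]
lemma pair_braiding_assoc (f : T ⟶ X) (g : T ⟶ Y) [Commutes f g] (k : Y ⊗ X ⟶ Z) :
    pair f g ≫ (β_ X Y).hom ≫ k = pair g f ≫ k := by
  rw [← pair_braiding f g, Category.assoc]

@[simp]
lemma pair_tensorμ (f : T ⟶ X) (g : T ⟶ Y) (h : T ⟶ X') (k : T ⟶ Y') [Commutes g h] :
    pair (pair f g) (pair h k) ≫ tensorμ X Y X' Y' = pair (pair f h) (pair g k) := by
  simp [tensorμ]

@[simp]
lemma pair_tensorμ_assoc (f : T ⟶ X) (g : T ⟶ Y) (h : T ⟶ X') (k : T ⟶ Y') [Commutes g h]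
    (l : (X ⊗ X') ⊗ (Y ⊗ Y') ⟶ Z) :
    pair (pair f g) (pair h k) ≫ tensorμ X Y X' Y' ≫ l = pair (pair f h) (pair g k) ≫ l := by
  rw [← pair_tensorμ f g h k, Category.assoc]

namespace Commutes

instance symm (f : T ⟶ X) (g : T ⟶ Y) [Commutes f g] : Commutes g f where
  pair_braiding' := by
    rw [← pair_braiding f g, Category.assoc, SymmetricCategory.symmetry, Category.comp_id]

instance comp_left (f : T ⟶ X) (g : T ⟶ Y) [Commutes f g] (p : X ⟶ X') :
    Commutes (f ≫ p) g where
  pair_braiding' := by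
    rw [← pair_whiskerRight, Category.assoc, BraidedCategory.braiding_naturality_left,
      pair_braiding_assoc, pair_whiskerLeft]

instance comp_right (f : T ⟶ X) (g : T ⟶ Y) [Commutes f g] (q : Y ⟶ Y') :
    Commutes f (g ≫ q) where
  pair_braiding' := by
    rw [← pair_whiskerLeft, Category.assoc, BraidedCategory.braiding_naturality_right,
      pair_braiding_assoc, pair_whiskerRight]

instance pair_right (f : T ⟶ X) (g : T ⟶ Y) (h : T ⟶ Z) [Commutes f g] [Commutes f h] :
    Commutes f (pair g h) where
  pair_braiding' := by simp

instance counit_right (f : T ⟶ X) : Commutes f ε[T] where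
  pair_braiding' := by simp [pair_counit_left, pair_counit_right]

instance precomp [ComonObj S] (w : S ⟶ T) [IsComonHom w] (f : T ⟶ X) (g : T ⟶ Y)
    [Commutes f g] : Commutes (w ≫ f) (w ≫ g) where
  pair_braiding' := by
    rw [← comp_pair, Category.assoc, pair_braiding, comp_pair]

end Commutes

/-- The coproducts give the order `x, x, y, y`, and the interchange swaps the inner `x` and `y`;
hence the need for `Commutes x y`. -/
instance isComonHom_pair [ComonObj X] [ComonObj Y] (x : T ⟶ X) (y : T ⟶ Y) [IsComonHom x]
    [IsComonHom y] [Commutes x y] : IsComonHom (pair x y) where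
  hom_counit := by
    rw [Comon.tensorObj_counit, pair_tensorHom_assoc, IsComonHom.hom_counit, IsComonHom.hom_counit,
      pair_leftUnitor]
  hom_comul := by
    rw [Comon.tensorObj_comul, pair_tensorHom_assoc, comp_comul, comp_comul, pair_tensorμ]
    rfl

end Braided

end Elements

/-! ### Projections of a tensor product of comonoids -/

section Projections

open scoped ComonObj

variable {C : Type u} [Category.{v} C] [MonoidalCategory C] {T X Y Z W : C}

variable (X Y) in
/-- The projection `X ⊗ Y ⟶ X` given by the counit of `Y`. -/
def proj₁ [ComonObj Y] : X ⊗ Y ⟶ X := (𝟙 X ⊗ₘ ε[Y]) ≫ (ρ_ X).hom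

variable (X Y) in
/-- The projection `X ⊗ Y ⟶ Y` given by the counit of `X`. -/
def proj₂ [ComonObj X] : X ⊗ Y ⟶ Y := (ε[X] ⊗ₘ 𝟙 Y) ≫ (λ_ Y).hom

lemma pair_proj₁ [ComonObj T] [ComonObj Y] (f : T ⟶ X) (g : T ⟶ Y) (hg : g ≫ ε[Y] = ε[T]) :
    pair f g ≫ proj₁ X Y = f := by
  rw [proj₁, pair_tensorHom_assoc, hg, pair_rightUnitor, Category.comp_id]

lemma pair_proj₂ [ComonObj T] [ComonObj X] (f : T ⟶ X) (g : T ⟶ Y) (hf : f ≫ ε[X] = ε[T]) :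
    pair f g ≫ proj₂ X Y = g := by
  rw [proj₂, pair_tensorHom_assoc, hf, pair_leftUnitor, Category.comp_id]

lemma comul_tensorHom_counit [ComonObj X] : Δ[X] ≫ (ε[X] ⊗ₘ ε[X]) = ε[X] ≫ (λ_ (𝟙_ C)).inv := by
  rw [← pair_counit_left]; rfl

lemma comul_tensorHom_id_counit [ComonObj X] : Δ[X] ≫ (𝟙 X ⊗ₘ ε[X]) = (ρ_ X).inv := by
  simp

lemma comul_tensorHom_counit_id [ComonObj X] : Δ[X] ≫ (ε[X] ⊗ₘ 𝟙 X) = (λ_ X).inv := by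
  simp

variable [SymmetricCategory C]

lemma tensorμ_unit_middle :
    tensorμ X (𝟙_ C) (𝟙_ C) Y = 𝟙 _ := by
  simp [tensorμ, unitors_inv_equal]

lemma tensorμ_unit_outer :
    tensorμ (𝟙_ C) X Y (𝟙_ C) ≫ ((λ_ Y).hom ⊗ₘ (ρ_ X).hom) =
      ((λ_ X).hom ⊗ₘ (ρ_ Y).hom) ≫ (β_ X Y).hom := by
  simp only [tensorμ]
  calc
    _ = 𝟙 _ ⊗≫ (β_ X Y).hom ⊗≫ 𝟙 _ := by monoidal
    _ = _ := by monoidal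

variable [ComonObj X] [ComonObj Y]

/-- The counits kill exactly the two factors that `tensorμ` exchanges, so the interchange becomes
trivial. -/
lemma pair_projections : pair (proj₁ X Y) (proj₂ X Y) = 𝟙 (X ⊗ Y) := by
  rw [pair, Comon.tensorObj_comul, proj₁, proj₂, Category.assoc,
    ← MonoidalCategory.tensorHom_comp_tensorHom, ← tensorμ_natural_assoc,
    MonoidalCategory.tensorHom_comp_tensorHom_assoc, comul_tensorHom_id_counit,
    comul_tensorHom_counit_id, tensorμ_unit_middle, Category.id_comp,
    MonoidalCategory.tensorHom_comp_tensorHom]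
  simp

lemma pair_comp_projections [ComonObj T] (w : T ⟶ X ⊗ Y) [IsComonHom w] :
    pair (w ≫ proj₁ X Y) (w ≫ proj₂ X Y) = w := by
  rw [← comp_pair, pair_projections, Category.comp_id]

/-- Morphisms out of `X ⊗ Y` agree if they agree on the pair of the two projections. -/
lemma ext_projections {f g : X ⊗ Y ⟶ Z}
    (h : pair (proj₁ X Y) (proj₂ X Y) ≫ f = pair (proj₁ X Y) (proj₂ X Y) ≫ g) : f = g := by
  simpa only [pair_projections, Category.id_comp] using h

instance isComonHom_proj₁ : IsComonHom (proj₁ X Y) where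
  hom_counit := by
    rw [Comon.tensorObj_counit, proj₁, Category.assoc, ← rightUnitor_naturality,
      unitors_equal, ← tensorHom_id, MonoidalCategory.tensorHom_comp_tensorHom_assoc]
    simp
  hom_comul := by
    rw [Comon.tensorObj_comul, proj₁, ← MonoidalCategory.tensorHom_comp_tensorHom, Category.assoc,
      Category.assoc, ← tensorμ_natural_assoc, MonoidalCategory.tensorHom_comp_tensorHom_assoc,
      comul_tensorHom_counit, ← Category.comp_id Δ[X], ← MonoidalCategory.tensorHom_comp_tensorHom,
      MonoidalCategory.id_tensorHom_id, id_tensorHom (X ⊗ X), Category.assoc, ← tensor_right_unitality, Category.comp_id,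
      ← rightUnitor_naturality, ← tensorHom_id, MonoidalCategory.tensorHom_comp_tensorHom_assoc]
    simp

instance isComonHom_proj₂ : IsComonHom (proj₂ X Y) where
  hom_counit := by
    rw [Comon.tensorObj_counit, proj₂, Category.assoc,
      ← leftUnitor_naturality, ← id_tensorHom, MonoidalCategory.tensorHom_comp_tensorHom_assoc]
    simp
  hom_comul := by
    rw [Comon.tensorObj_comul, proj₂, ← MonoidalCategory.tensorHom_comp_tensorHom, Category.assoc,
      Category.assoc, ← tensorμ_natural_assoc, MonoidalCategory.tensorHom_comp_tensorHom_assoc,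
      comul_tensorHom_counit, ← Category.comp_id Δ[Y], ← MonoidalCategory.tensorHom_comp_tensorHom,
      MonoidalCategory.id_tensorHom_id, tensorHom_id _ (Y ⊗ Y), Category.assoc, ← tensor_left_unitality, Category.comp_id,
      ← leftUnitor_naturality, ← id_tensorHom, MonoidalCategory.tensorHom_comp_tensorHom_assoc]
    simp

/-- With the projections in the opposite order the counits kill the outer factors, and the
interchange reduces to the braiding. -/
instance commutes_projections : Commutes (proj₁ X Y) (proj₂ X Y) where
  pair_braiding' := by
    rw [pair_projections, Category.id_comp, pair, Comon.tensorObj_comul, proj₁, proj₂,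
      Category.assoc, ← MonoidalCategory.tensorHom_comp_tensorHom, ← tensorμ_natural_assoc,
      MonoidalCategory.tensorHom_comp_tensorHom_assoc, comul_tensorHom_id_counit,
      comul_tensorHom_counit_id, tensorμ_unit_outer,
      MonoidalCategory.tensorHom_comp_tensorHom_assoc]
    simp

end Projections

/-! ### Hopf algebra laws on elements, and the tensor product Hopf algebra -/

section Laws

open scoped ComonObj

variable {C : Type u} [Category.{v} C] [MonoidalCategory C] [SymmetricCategory C]
  {T A H X Y Z W : C}

/-- The tuple satisfies the Hopf algebra laws over the given coalgebra. -/
class Laws [ComonObj X] (P : HopfTuple X) : Prop where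
  comul_eq : P.comul = Δ[X]
  counit_eq : P.counit = ε[X]
  one_mul : P.one ▷ X ≫ P.mul = (λ_ X).hom
  mul_one : X ◁ P.one ≫ P.mul = (ρ_ X).hom
  mul_assoc : P.mul ▷ X ≫ P.mul = (α_ X X X).hom ≫ X ◁ P.mul ≫ P.mul
  isComonHom_mul : IsComonHom P.mul
  one_comul : P.one ≫ Δ[X] = (λ_ (𝟙_ C)).inv ≫ (P.one ⊗ₘ P.one)
  one_counit : P.one ≫ ε[X] = 𝟙 (𝟙_ C)
  antipode_left : Δ[X] ≫ P.antipode ▷ X ≫ P.mul = ε[X] ≫ P.one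
  antipode_right : Δ[X] ≫ X ◁ P.antipode ≫ P.mul = ε[X] ≫ P.one

attribute [instance] Laws.isComonHom_mul

/-- Identifying the underlying comonoid with the ambient instance lets both Hopf algebras of a brace
share one coalgebra. -/
lemma Laws.of_isHopfAlgebra [c : ComonObj X] {P : HopfTuple X} (hP : P.IsHopfAlgebra)
    (comul_eq : P.comul = Δ[X]) (counit_eq : P.counit = ε[X]) : Laws P := by
  obtain ⟨j, rfl⟩ := hP
  obtain rfl : c = j.toComonObj := by
    cases c
    obtain rfl := comul_eq
    obtain rfl := counit_eq
    rfl
  exact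
    { comul_eq := rfl
      counit_eq := rfl
      one_mul := MonObj.one_mul X
      mul_one := MonObj.mul_one X
      mul_assoc := MonObj.mul_assoc X
      isComonHom_mul :=
        { hom_counit := BimonObj.mul_counit X
          hom_comul := by
            rw [Comon.tensorObj_comul, Category.assoc]
            exact BimonObj.mul_comul X }
      one_comul := BimonObj.one_comul X
      one_counit := BimonObj.one_counit X
      antipode_left := HopfObj.antipode_left X
      antipode_right := HopfObj.antipode_right X }

lemma Laws.isHopfAlgebra [ComonObj X] (P : HopfTuple X) [L : Laws P] : P.IsHopfAlgebra :=
  ⟨{ one := P.one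
     mul := P.mul
     one_mul := L.one_mul
     mul_one := L.mul_one
     mul_assoc := L.mul_assoc
     counit := ε[X]
     comul := Δ[X]
     counit_comul := ComonObj.counit_comul X
     comul_counit := ComonObj.comul_counit X
     comul_assoc := ComonObj.comul_assoc X
     mul_comul := by
       have := L.isComonHom_mul.hom_comul
       rwa [Comon.tensorObj_comul, Category.assoc] at this
     one_comul := L.one_comul
     mul_counit := L.isComonHom_mul.hom_counit
     one_counit := L.one_counit
     antipode := P.antipode
     antipode_left := L.antipode_left
     antipode_right := L.antipode_right },
   HopfTuple.ext rfl rfl L.counit_eq.symm L.comul_eq.symm rfl⟩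

lemma Laws.antipode_counit [ComonObj X] (P : HopfTuple X) [L : Laws P] :
    P.antipode ≫ ε[X] = ε[X] := by
  obtain ⟨j, hj⟩ := isHopfAlgebra P
  rw [← L.counit_eq, ← hj]
  exact HopfObj.antipode_counit X

/-- Associativity may be checked on pairwise commuting generalized elements. -/
lemma ext_mul_assoc [ComonObj X] {m : X ⊗ X ⟶ X}
    (mul_assoc : ∀ {T : C} [ComonObj T] (x y z : T ⟶ X) [IsComonHom x] [IsComonHom y]
      [IsComonHom z] [Commutes x y] [Commutes x z] [Commutes y z],
      pair (pair x y ≫ m) z ≫ m = pair x (pair y z ≫ m) ≫ m) :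
    m ▷ X ≫ m = (α_ X X X).hom ≫ X ◁ m ≫ m := by
  refine ext_projections ?_
  rw [← pair_comp_projections (proj₁ (X ⊗ X) X), pair_whiskerRight_assoc,
    pair_associator_hom_assoc, pair_whiskerLeft_assoc]
  exact mul_assoc _ _ _

/-- The Hopf algebra laws may be checked on generalized elements. -/
lemma Laws.of_elements [ComonObj X] {P : HopfTuple X} (comul_eq : P.comul = Δ[X])
    (counit_eq : P.counit = ε[X])
    (isComonHom_one : ∀ (T : C) [ComonObj T], IsComonHom (ε[T] ≫ P.one))
    (isComonHom_mul : ∀ {T : C} [ComonObj T] (x y : T ⟶ X) [IsComonHom x] [IsComonHom y]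
      [Commutes x y], IsComonHom (pair x y ≫ P.mul))
    (one_mul : ∀ {T : C} [ComonObj T] (x : T ⟶ X) [IsComonHom x],
      pair (ε[T] ≫ P.one) x ≫ P.mul = x)
    (mul_one : ∀ {T : C} [ComonObj T] (x : T ⟶ X) [IsComonHom x],
      pair x (ε[T] ≫ P.one) ≫ P.mul = x)
    (mul_assoc : P.mul ▷ X ≫ P.mul = (α_ X X X).hom ≫ X ◁ P.mul ≫ P.mul)
    (antipode_left : ∀ {T : C} [ComonObj T] (x : T ⟶ X) [IsComonHom x],
      pair (x ≫ P.antipode) x ≫ P.mul = ε[T] ≫ P.one)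
    (antipode_right : ∀ {T : C} [ComonObj T] (x : T ⟶ X) [IsComonHom x],
      pair x (x ≫ P.antipode) ≫ P.mul = ε[T] ≫ P.one) : Laws P where
  comul_eq := comul_eq
  counit_eq := counit_eq
  one_mul := by
    have := one_mul (𝟙 X)
    rw [pair_point_left, Category.id_comp, Category.assoc, Iso.inv_comp_eq] at this
    simpa using this
  mul_one := by
    have := mul_one (𝟙 X)
    rw [pair_point_right, Category.id_comp, Category.assoc, Iso.inv_comp_eq] at this
    simpa using this
  mul_assoc := mul_assoc
  isComonHom_mul := by
    have := isComonHom_mul (proj₁ X X) (proj₂ X X)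
    rwa [pair_projections, Category.id_comp] at this
  one_comul := by
    -- At `T = 𝟙_ C` the counit is the identity, so `ε[T] ≫ P.one` is the unit itself.
    let := ComonObj.instTensorUnit C
    have := (isComonHom_one (𝟙_ C)).hom_comul
    simpa using this
  one_counit := by
    let := ComonObj.instTensorUnit C
    have := (isComonHom_one (𝟙_ C)).hom_counit
    simpa using this
  antipode_left := by
    have := antipode_left (𝟙 X)
    rwa [Category.id_comp, pair, tensorHom_id, Category.assoc] at this
  antipode_right := by
    have := antipode_right (𝟙 X)
    rwa [Category.id_comp, pair, id_tensorHom, Category.assoc] at this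

section Elements

variable [ComonObj T] [ComonObj X] (P Q : HopfTuple X) [Laws P]

@[simp]
lemma comp_comul_eq (x : T ⟶ X) [IsComonHom x] : x ≫ P.comul = pair x x := by
  rw [Laws.comul_eq, comp_comul]

@[simp]
lemma comp_counit_eq (x : T ⟶ X) [IsComonHom x] : x ≫ P.counit = ε[T] := by
  rw [Laws.counit_eq, IsComonHom.hom_counit]

@[simp]
lemma comp_counit_eq_assoc (x : T ⟶ X) [IsComonHom x] (k : 𝟙_ C ⟶ Z) :
    x ≫ P.counit ≫ k = ε[T] ≫ k := by
  rw [← comp_counit_eq P x, Category.assoc]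

@[simp]
lemma pair_one_left_mul (x : T ⟶ X) : pair (ε[T] ≫ P.one) x ≫ P.mul = x := by
  rw [← pair_whiskerRight_assoc, Laws.one_mul, pair_leftUnitor]

@[simp]
lemma pair_one_right_mul (x : T ⟶ X) : pair x (ε[T] ≫ P.one) ≫ P.mul = x := by
  rw [← pair_whiskerLeft_assoc, Laws.mul_one, pair_rightUnitor]

lemma pair_mul_assoc (x y z : T ⟶ X) :
    pair (pair x y ≫ P.mul) z ≫ P.mul = pair x (pair y z ≫ P.mul) ≫ P.mul := by
  rw [← pair_whiskerRight_assoc, Laws.mul_assoc, pair_associator_hom_assoc,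
    pair_whiskerLeft_assoc]

instance isComonHom_one : IsComonHom (ε[T] ≫ P.one) where
  hom_counit := by rw [Category.assoc, Laws.one_counit, Category.comp_id]
  hom_comul := by
    rw [Category.assoc, Laws.one_comul]
    change _ = pair _ _
    rw [← pair_tensorHom, pair_counit_left, Category.assoc]

@[simp]
lemma pair_antipode_left (x : T ⟶ X) [IsComonHom x] :
    pair (x ≫ P.antipode) x ≫ P.mul = ε[T] ≫ P.one := by
  rw [← pair_whiskerRight_assoc, ← comp_comul, Category.assoc, Laws.antipode_left,
    IsComonHom.hom_counit_assoc]

@[simp]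
lemma pair_antipode_right (x : T ⟶ X) [IsComonHom x] :
    pair x (x ≫ P.antipode) ≫ P.mul = ε[T] ≫ P.one := by
  rw [← pair_whiskerLeft_assoc, ← comp_comul, Category.assoc, Laws.antipode_right,
    IsComonHom.hom_counit_assoc]

lemma pair_mul_counit (x y : T ⟶ X) (hx : x ≫ ε[X] = ε[T]) (hy : y ≫ ε[X] = ε[T]) :
    (pair x y ≫ P.mul) ≫ ε[X] = ε[T] := by
  rw [Category.assoc, IsComonHom.hom_counit, Comon.tensorObj_counit, pair_tensorHom_assoc, hx, hy,
    pair_leftUnitor]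

@[simp]
lemma pair_gamma (x y : T ⟶ X) [IsComonHom x] :
    pair x y ≫ gamma P Q = pair (x ≫ P.antipode) (pair x y ≫ Q.mul) ≫ P.mul := by
  simp [gamma]

end Elements

section Tensor

variable [ComonObj T] (P : HopfTuple A) (Q : HopfTuple H)

lemma pair_tensor_mul (a b : T ⟶ A) (h g : T ⟶ H) [Commutes h b] :
    pair (pair a h) (pair b g) ≫ (P.tensor Q).mul =
      pair (pair a b ≫ P.mul) (pair h g ≫ Q.mul) := by
  simp [tensor]

lemma pair_tensor_antipode (a : T ⟶ A) (h : T ⟶ H) :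
    pair a h ≫ (P.tensor Q).antipode = pair (a ≫ P.antipode) (h ≫ Q.antipode) := by
  simp [tensor]

lemma counit_tensor_one :
    ε[T] ≫ (P.tensor Q).one = pair (ε[T] ≫ P.one) (ε[T] ≫ Q.one) := by
  rw [← pair_tensorHom, pair_counit_left, tensor, Category.assoc]

variable [ComonObj A] [ComonObj H]

lemma tensor_comul [Laws P] [Laws Q] : (P.tensor Q).comul = Δ[A ⊗ H] := by
  rw [Comon.tensorObj_comul, ← Laws.comul_eq (P := P), ← Laws.comul_eq (P := Q), tensor]

lemma tensor_counit [Laws P] [Laws Q] : (P.tensor Q).counit = ε[A ⊗ H] := by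
  rw [Comon.tensorObj_counit, ← Laws.counit_eq (P := P), ← Laws.counit_eq (P := Q), tensor]

instance isComonHom_tensor_one [Laws P] [Laws Q] : IsComonHom (ε[T] ≫ (P.tensor Q).one) := by
  rw [counit_tensor_one]
  infer_instance

instance laws_tensor [Laws P] [Laws Q] : Laws (P.tensor Q) := by
  refine Laws.of_elements (tensor_comul P Q) (tensor_counit P Q) (fun T _ ↦ inferInstance) ?_ ?_ ?_
    ?_ ?_ ?_
  · intro T _ x y _ _ _
    rw [← pair_comp_projections x, ← pair_comp_projections y, pair_tensor_mul]
    infer_instance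
  · intro T _ x _
    conv_lhs => rw [← pair_comp_projections x]
    rw [counit_tensor_one, pair_tensor_mul, pair_one_left_mul, pair_one_left_mul,
      pair_comp_projections]
  · intro T _ x _
    conv_lhs => rw [← pair_comp_projections x]
    rw [counit_tensor_one, pair_tensor_mul, pair_one_right_mul, pair_one_right_mul,
      pair_comp_projections]
  · refine ext_mul_assoc fun x y z _ _ _ _ _ _ ↦ ?_
    rw [← pair_comp_projections x, ← pair_comp_projections y, ← pair_comp_projections z]
    simp only [pair_tensor_mul, pair_mul_assoc]
  · intro T _ x _
    rw [← pair_comp_projections x, pair_tensor_antipode, pair_tensor_mul, pair_antipode_left,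
      pair_antipode_left, counit_tensor_one]
  · intro T _ x _
    rw [← pair_comp_projections x, pair_tensor_antipode, pair_tensor_mul, pair_antipode_right,
      pair_antipode_right, counit_tensor_one]

end Tensor

end Laws

/-! ### The bicrossed product of a matched pair -/

section MatchedPair

open scoped ComonObj

variable {C : Type u} [Category.{v} C] [MonoidalCategory C] [SymmetricCategory C]
  {T A H : C}

namespace IsMatchedPair

variable [ComonObj T] {P : HopfTuple A} {Q : HopfTuple H} {φ : H ⊗ A ⟶ A} {ϕ : H ⊗ A ⟶ H}

lemma pair_one_left_act (hm : IsMatchedPair P Q φ ϕ) (a : T ⟶ A) :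
    pair (ε[T] ≫ Q.one) a ≫ φ = a := by
  rw [← pair_whiskerRight_assoc, hm.left_module.one_act, pair_leftUnitor]

lemma pair_act_one_right (hm : IsMatchedPair P Q φ ϕ) (h : T ⟶ H) :
    pair h (ε[T] ≫ P.one) ≫ ϕ = h := by
  rw [← pair_whiskerLeft_assoc, hm.right_module.act_one, pair_rightUnitor]

lemma pair_mul_left_act (hm : IsMatchedPair P Q φ ϕ) (h g : T ⟶ H) (a : T ⟶ A) :
    pair (pair h g ≫ Q.mul) a ≫ φ = pair h (pair g a ≫ φ) ≫ φ := by
  rw [← pair_whiskerRight_assoc, hm.left_module.mul_act, pair_associator_hom_assoc,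
    pair_whiskerLeft_assoc]

lemma pair_act_mul_right (hm : IsMatchedPair P Q φ ϕ) (h : T ⟶ H) (a b : T ⟶ A) :
    pair h (pair a b ≫ P.mul) ≫ ϕ = pair (pair h a ≫ ϕ) b ≫ ϕ := by
  rw [← pair_whiskerLeft_assoc, hm.right_module.act_mul, pair_associator_inv_assoc,
    pair_whiskerRight_assoc]

lemma pair_bicrossed_antipode (a : T ⟶ A) (h : T ⟶ H) [Commutes a h] :
    pair a h ≫ (P.bicrossed Q φ ϕ).antipode =
      pair (h ≫ Q.antipode) (a ≫ P.antipode) ≫ psi P Q φ ϕ := by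
  simp [bicrossed]

variable [ComonObj A] [ComonObj H]

omit [ComonObj H] in
lemma pair_one_act (hm : IsMatchedPair P Q φ ϕ) (a : T ⟶ A) [Laws P] [IsComonHom a] :
    pair (ε[T] ≫ Q.one) a ≫ ϕ = ε[T] ≫ Q.one := by
  rw [← pair_whiskerRight_assoc, hm.one_act]
  simp

omit [ComonObj A] in
lemma pair_act_one (hm : IsMatchedPair P Q φ ϕ) (h : T ⟶ H) [Laws Q] [IsComonHom h] :
    pair h (ε[T] ≫ P.one) ≫ φ = ε[T] ≫ P.one := by
  rw [← pair_whiskerLeft_assoc, hm.act_one]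
  simp [unitors_equal]

variable [Laws P] [Laws Q]

lemma isComonHom_left (hm : IsMatchedPair P Q φ ϕ) : IsComonHom φ where
  hom_counit := by
    rw [Comon.tensorObj_counit, ← Laws.counit_eq (P := P), ← Laws.counit_eq (P := Q)]
    exact hm.left_module.act_counit
  hom_comul := by
    rw [Comon.tensorObj_comul, ← Laws.comul_eq (P := P), ← Laws.comul_eq (P := Q), Category.assoc]
    exact hm.left_module.act_comul

lemma isComonHom_right (hm : IsMatchedPair P Q φ ϕ) : IsComonHom ϕ where
  hom_counit := by
    rw [Comon.tensorObj_counit, ← Laws.counit_eq (P := P), ← Laws.counit_eq (P := Q)]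
    exact hm.right_module.act_counit
  hom_comul := by
    rw [Comon.tensorObj_comul, ← Laws.comul_eq (P := P), ← Laws.comul_eq (P := Q), Category.assoc]
    exact hm.right_module.act_comul

lemma pair_psi (h : T ⟶ H) (a : T ⟶ A) [IsComonHom h] [IsComonHom a] [Commutes h a] :
    pair h a ≫ psi P Q φ ϕ = pair (pair h a ≫ φ) (pair h a ≫ ϕ) := by
  simp [psi]

/-- The braiding axiom for `Ψ`, read on elements. It replaces cocommutativity throughout the
construction of the bicrossed product. -/
lemma commutes_actions (hm : IsMatchedPair P Q φ ϕ) (h : T ⟶ H) (a : T ⟶ A) [IsComonHom h]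
    [IsComonHom a] [Commutes h a] : Commutes (pair h a ≫ φ) (pair h a ≫ ϕ) where
  pair_braiding' := by
    rw [← pair_psi (P := P) (Q := Q), Category.assoc, hm.psi_braiding]
    simp

lemma pair_act_mul (hm : IsMatchedPair P Q φ ϕ) (h : T ⟶ H) (a b : T ⟶ A) [IsComonHom h]
    [IsComonHom a] [Commutes h a] :
    pair h (pair a b ≫ P.mul) ≫ φ =
      pair (pair h a ≫ φ) (pair (pair h a ≫ ϕ) b ≫ φ) ≫ P.mul := by
  rw [← pair_whiskerLeft_assoc, hm.act_mul, pair_associator_inv_assoc, pair_whiskerRight_assoc,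
    pair_psi, pair_associator_hom_assoc, pair_whiskerLeft_assoc]

lemma pair_mul_act (hm : IsMatchedPair P Q φ ϕ) (h g : T ⟶ H) (a : T ⟶ A) [IsComonHom g]
    [IsComonHom a] [Commutes g a] :
    pair (pair h g ≫ Q.mul) a ≫ ϕ =
      pair (pair h (pair g a ≫ φ) ≫ ϕ) (pair g a ≫ ϕ) ≫ Q.mul := by
  rw [← pair_whiskerRight_assoc, hm.mul_act, pair_associator_hom_assoc, pair_whiskerLeft_assoc,
    pair_psi, pair_associator_inv_assoc, pair_whiskerRight_assoc]

/-- The identity is proved for the universal element `𝟙 A` and then precomposed, so `a` need not be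
a comonoid morphism. This generality is needed for values of the antipode. -/
lemma pair_one_psi (hm : IsMatchedPair P Q φ ϕ) (a : T ⟶ A) :
    pair (ε[T] ≫ Q.one) a ≫ psi P Q φ ϕ = pair a (ε[T] ≫ Q.one) := by
  have key := pair_psi (P := P) (Q := Q) (φ := φ) (ϕ := ϕ) (ε[A] ≫ Q.one) (𝟙 A)
  rw [hm.pair_one_left_act, hm.pair_one_act, pair_point_left, pair_point_right,
    Category.id_comp, Category.id_comp] at key
  rw [pair_point_left, pair_point_right, Category.assoc, key]

lemma pair_psi_one (hm : IsMatchedPair P Q φ ϕ) (h : T ⟶ H) :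
    pair h (ε[T] ≫ P.one) ≫ psi P Q φ ϕ = pair (ε[T] ≫ P.one) h := by
  have key := pair_psi (P := P) (Q := Q) (φ := φ) (ϕ := ϕ) (𝟙 H) (ε[H] ≫ P.one)
  rw [hm.pair_act_one, hm.pair_act_one_right, pair_point_left, pair_point_right,
    Category.id_comp, Category.id_comp] at key
  rw [pair_point_left, pair_point_right, Category.assoc, key]

variable (P Q φ ϕ) in
lemma pair_bicrossed_mul (a b : T ⟶ A) (h g : T ⟶ H) [IsComonHom h] [IsComonHom b]
    [Commutes h b] :
    pair (pair a h) (pair b g) ≫ (P.bicrossed Q φ ϕ).mul =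
      pair (pair a (pair h b ≫ φ) ≫ P.mul) (pair (pair h b ≫ ϕ) g ≫ Q.mul) := by
  simp [bicrossed, pair_psi]

lemma pair_one_bicrossed_mul (hm : IsMatchedPair P Q φ ϕ) (a b : T ⟶ A) (g : T ⟶ H) :
    pair (pair a (ε[T] ≫ Q.one)) (pair b g) ≫ (P.bicrossed Q φ ϕ).mul =
      pair (pair a b ≫ P.mul) g := by
  simp [bicrossed, hm.pair_one_psi]

lemma pair_bicrossed_mul_one (hm : IsMatchedPair P Q φ ϕ) (a : T ⟶ A) (h g : T ⟶ H) :
    pair (pair a h) (pair (ε[T] ≫ P.one) g) ≫ (P.bicrossed Q φ ϕ).mul =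
      pair a (pair h g ≫ Q.mul) := by
  simp [bicrossed, hm.pair_psi_one]

/-- The factorization `Ψ(h, a) = (1, h)(a, 1)`, checked on the projections of `H ⊗ A` so that it
holds for arbitrary `h` and `a`. -/
lemma pair_psi_eq_bicrossed_mul (h : T ⟶ H) (a : T ⟶ A) :
    pair h a ≫ psi P Q φ ϕ =
      pair (pair (ε[T] ≫ P.one) h) (pair a (ε[T] ≫ Q.one)) ≫ (P.bicrossed Q φ ϕ).mul := by
  have key : psi P Q φ ϕ = (((λ_ H).inv ≫ P.one ▷ H) ⊗ₘ ((ρ_ A).inv ≫ A ◁ Q.one)) ≫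
      (P.bicrossed Q φ ϕ).mul := by
    refine ext_projections ?_
    rw [pair_tensorHom_assoc, ← pair_point_left, ← pair_point_right, pair_bicrossed_mul,
      pair_one_left_mul, pair_one_right_mul, pair_psi]
  rw [key, pair_tensorHom_assoc, ← pair_point_left, ← pair_point_right]

lemma bicrossed_mul_assoc (hm : IsMatchedPair P Q φ ϕ) :
    (P.bicrossed Q φ ϕ).mul ▷ (A ⊗ H) ≫ (P.bicrossed Q φ ϕ).mul =
      (α_ _ _ _).hom ≫ (A ⊗ H) ◁ (P.bicrossed Q φ ϕ).mul ≫ (P.bicrossed Q φ ϕ).mul := by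
  have := hm.isComonHom_left
  have := hm.isComonHom_right
  refine ext_mul_assoc fun x y z _ _ _ _ _ _ ↦ ?_
  have := hm.commutes_actions (x ≫ proj₂ A H) (y ≫ proj₁ A H)
  have := hm.commutes_actions (y ≫ proj₂ A H) (z ≫ proj₁ A H)
  rw [← pair_comp_projections x, ← pair_comp_projections y, ← pair_comp_projections z]
  simp only [pair_bicrossed_mul]
  rw [hm.pair_act_mul, hm.pair_mul_left_act, hm.pair_mul_act, hm.pair_act_mul_right,
    pair_mul_assoc, pair_mul_assoc]

lemma pair_bicrossed_mul_assoc (hm : IsMatchedPair P Q φ ϕ) (x y z : T ⟶ A ⊗ H) :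
    pair (pair x y ≫ (P.bicrossed Q φ ϕ).mul) z ≫ (P.bicrossed Q φ ϕ).mul =
      pair x (pair y z ≫ (P.bicrossed Q φ ϕ).mul) ≫ (P.bicrossed Q φ ϕ).mul := by
  rw [← pair_whiskerRight_assoc, hm.bicrossed_mul_assoc, pair_associator_hom_assoc,
    pair_whiskerLeft_assoc]

set_option synthInstance.maxSize 4000 in
lemma laws_bicrossed (hm : IsMatchedPair P Q φ ϕ) : Laws (P.bicrossed Q φ ϕ) := by
  have := hm.isComonHom_left
  have := hm.isComonHom_right
  have one_eq : ∀ (T : C) [ComonObj T], ε[T] ≫ (P.bicrossed Q φ ϕ).one =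
    pair (ε[T] ≫ P.one) (ε[T] ≫ Q.one) := fun T _ ↦ counit_tensor_one P Q
  refine Laws.of_elements (tensor_comul P Q) (tensor_counit P Q)
    (fun T _ ↦ isComonHom_tensor_one P Q) ?_ ?_ ?_ hm.bicrossed_mul_assoc ?_ ?_
  · intro T _ x y _ _ _
    have := hm.commutes_actions (x ≫ proj₂ A H) (y ≫ proj₁ A H)
    rw [← pair_comp_projections x, ← pair_comp_projections y, pair_bicrossed_mul]
    infer_instance
  · intro T _ x _
    conv_lhs => rw [← pair_comp_projections x]
    rw [one_eq, hm.pair_one_bicrossed_mul, pair_one_left_mul, pair_comp_projections]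
  · intro T _ x _
    conv_lhs => rw [← pair_comp_projections x]
    rw [one_eq, hm.pair_bicrossed_mul_one, pair_one_right_mul, pair_comp_projections]
  · intro T _ x _
    -- For `x = (a, h)` the antipode is `(1, S h)(S a, 1)`, so the product telescopes: `(S a, 1)(a,
    -- h) = (1, h)`, then `(1, S h)(1, h) = 1`.
    rw [← pair_comp_projections x, pair_bicrossed_antipode, pair_psi_eq_bicrossed_mul,
      hm.pair_bicrossed_mul_assoc, hm.pair_one_bicrossed_mul, pair_antipode_left,
      hm.pair_bicrossed_mul_one, pair_antipode_left, one_eq]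
  · intro T _ x _
    -- Here `(a, h)(1, S h) = (a, 1)`, then `(a, 1)(S a, 1) = 1`.
    rw [← pair_comp_projections x, pair_bicrossed_antipode, pair_psi_eq_bicrossed_mul,
      ← hm.pair_bicrossed_mul_assoc, hm.pair_bicrossed_mul_one, pair_antipode_right,
      hm.pair_one_bicrossed_mul, pair_antipode_right, one_eq]

end IsMatchedPair

end MatchedPair

/-! ### Brace compatibility and the conditions (E1), (E2) -/

section Brace

open scoped ComonObj

variable {C : Type u} [Category.{v} C] [MonoidalCategory C] [SymmetricCategory C]
  {T X A H : C}

/-- The only way in which cocommutativity of `H` enters. -/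
lemma IsCocommutative.commutes_self [ComonObj T] [ComonObj X] {P : HopfTuple X} [Laws P]
    (hP : P.IsCocommutative) (x : T ⟶ X) [IsComonHom x] : Commutes x x where
  pair_braiding' := by
    rw [← comp_comul_eq P, Category.assoc, hP]

/-- The compatibility condition of a Hopf brace. -/
def IsBraceCompatible (P Q : HopfTuple X) : Prop :=
  X ◁ P.mul ≫ Q.mul =
    P.comul ▷ (X ⊗ X) ≫ tensorμ X X X X ≫ (Q.mul ⊗ₘ gamma P Q) ≫ P.mul

lemma IsBraceCompatible.pair_mul [ComonObj T] [ComonObj X] {P Q : HopfTuple X} [Laws P]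
    (hPQ : IsBraceCompatible P Q) (x y z : T ⟶ X) [IsComonHom x] [Commutes x y] :
    pair x (pair y z ≫ P.mul) ≫ Q.mul =
      pair (pair x y ≫ Q.mul) (pair x z ≫ gamma P Q) ≫ P.mul := by
  rw [← pair_whiskerLeft_assoc, hPQ]
  simp [-pair_gamma]

lemma IsBraceCompatible.of_elements [ComonObj X] {P Q : HopfTuple X} [Laws P]
    (hPQ : ∀ {T : C} [ComonObj T] (x y z : T ⟶ X) [IsComonHom x] [IsComonHom y] [IsComonHom z]
      [Commutes x y] [Commutes x z] [Commutes y z],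
      pair x (pair y z ≫ P.mul) ≫ Q.mul =
        pair (pair x y ≫ Q.mul) (pair x z ≫ gamma P Q) ≫ P.mul) :
    IsBraceCompatible P Q := by
  refine ext_projections ?_
  rw [← pair_comp_projections (proj₂ X (X ⊗ X)), pair_whiskerLeft_assoc, hPQ]
  simp [-pair_gamma]

section Conditions

variable {A₁ A₂ : HopfTuple A} {H₁ H₂ : HopfTuple H} {φ : H ⊗ A ⟶ A} {ϕ : H ⊗ A ⟶ H}
  [ComonObj H] [Laws H₁]

lemma ConditionE1.pair_act_mul [ComonObj T] (hE : ConditionE1 A₁ H₁ φ) (h : T ⟶ H) (b c : T ⟶ A)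
    [IsComonHom h] [Commutes h b] :
    pair (pair h b ≫ φ) (pair h c ≫ φ) ≫ A₁.mul = pair h (pair b c ≫ A₁.mul) ≫ φ := by
  rw [← pair_whiskerLeft_assoc h (pair b c), ← hE]
  simp

lemma ConditionE1.of_elements [ComonObj A]
    (hE : ∀ {T : C} [ComonObj T] (h : T ⟶ H) (b c : T ⟶ A) [IsComonHom h] [IsComonHom b]
      [IsComonHom c] [Commutes h b] [Commutes h c] [Commutes b c],
      pair (pair h b ≫ φ) (pair h c ≫ φ) ≫ A₁.mul = pair h (pair b c ≫ A₁.mul) ≫ φ) :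
    ConditionE1 A₁ H₁ φ := by
  refine ext_projections ?_
  rw [← pair_comp_projections (proj₂ H (A ⊗ A)), pair_whiskerLeft_assoc, ← hE]
  simp

lemma pair_omega [ComonObj T] (h k : T ⟶ H) (c : T ⟶ A) [IsComonHom h] :
    pair h (pair c k) ≫ omega H₁ H₂ ϕ =
      pair (h ≫ H₁.antipode) (pair (pair h c ≫ ϕ) k ≫ H₂.mul) ≫ H₁.mul := by
  simp [omega]

lemma pair_conditionE2_left [ComonObj T] (h g k : T ⟶ H) (b c : T ⟶ A) [IsComonHom h]
    [Commutes h b] [Commutes h g] :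
    pair h (pair b (pair g (pair c k))) ≫ (α_ H A (H ⊗ A ⊗ H)).inv ≫
      (H₁.comul ▷ A ≫ (α_ H H A).hom ≫ H ◁ (β_ H A).hom ≫ (α_ H A H).inv ≫ ϕ ▷ H) ▷
        (H ⊗ A ⊗ H) ≫
      tensorμ H H H (A ⊗ H) ≫ (H₂.mul ⊗ₘ omega H₁ H₂ ϕ) ≫ H₁.mul =
    pair (pair (pair h b ≫ ϕ) g ≫ H₂.mul)
      (pair (h ≫ H₁.antipode) (pair (pair h c ≫ ϕ) k ≫ H₂.mul) ≫ H₁.mul) ≫ H₁.mul := by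
  rw [← pair_omega]
  simp

omit [ComonObj H] [Laws H₁] in
lemma pair_conditionE2_right [ComonObj T] (h g k : T ⟶ H) (b c : T ⟶ A) [Commutes g c] :
    pair h (pair b (pair g (pair c k))) ≫
      H ◁ A ◁ ((α_ H A H).inv ≫ (β_ H A).hom ▷ H ≫ (α_ A H H).hom) ≫
      H ◁ (α_ A A (H ⊗ H)).inv ≫ (α_ H (A ⊗ A) (H ⊗ H)).inv ≫
      ((H ◁ A₁.mul ≫ ϕ) ⊗ₘ H₁.mul) ≫ H₂.mul =
    pair (pair h (pair b c ≫ A₁.mul) ≫ ϕ) (pair g k ≫ H₁.mul) ≫ H₂.mul := by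
  simp

lemma ConditionE2.pair_mul [ComonObj T] (hE : ConditionE2 A₁ H₁ H₂ ϕ) (h g k : T ⟶ H)
    (b c : T ⟶ A) [IsComonHom h] [Commutes h b] [Commutes h g] [Commutes g c] :
    pair (pair (pair h b ≫ ϕ) g ≫ H₂.mul)
      (pair (h ≫ H₁.antipode) (pair (pair h c ≫ ϕ) k ≫ H₂.mul) ≫ H₁.mul) ≫ H₁.mul =
    pair (pair h (pair b c ≫ A₁.mul) ≫ ϕ) (pair g k ≫ H₁.mul) ≫ H₂.mul := by
  rw [← pair_conditionE2_left, ← pair_conditionE2_right]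
  exact congrArg _ hE

lemma ConditionE2.of_elements [ComonObj A]
    (hE : ∀ {T : C} [ComonObj T] (h g k : T ⟶ H) (b c : T ⟶ A) [IsComonHom h] [IsComonHom g]
      [IsComonHom k] [IsComonHom b] [IsComonHom c] [Commutes h b] [Commutes h g] [Commutes h c]
      [Commutes h k] [Commutes b g] [Commutes b c] [Commutes b k] [Commutes g c] [Commutes g k]
      [Commutes c k],
      pair (pair (pair h b ≫ ϕ) g ≫ H₂.mul)
        (pair (h ≫ H₁.antipode) (pair (pair h c ≫ ϕ) k ≫ H₂.mul) ≫ H₁.mul) ≫ H₁.mul =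
      pair (pair h (pair b c ≫ A₁.mul) ≫ ϕ) (pair g k ≫ H₁.mul) ≫ H₂.mul) :
    ConditionE2 A₁ H₁ H₂ ϕ := by
  refine ext_projections ?_
  -- Splitting the second projection repeatedly yields the five universal elements `h, b, g, c, k`.
  rw [← pair_comp_projections (proj₂ H (A ⊗ H ⊗ A ⊗ H)),
    ← pair_comp_projections (proj₂ H (A ⊗ H ⊗ A ⊗ H) ≫ proj₂ A (H ⊗ A ⊗ H)),
    ← pair_comp_projections ((proj₂ H (A ⊗ H ⊗ A ⊗ H) ≫ proj₂ A (H ⊗ A ⊗ H)) ≫ proj₂ H (A ⊗ H)),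
    pair_conditionE2_left, pair_conditionE2_right]
  exact hE _ _ _ _ _

end Conditions

section Bicrossed

variable [ComonObj T] [ComonObj A] [ComonObj H] {A₁ A₂ : HopfTuple A} {H₁ H₂ : HopfTuple H}
  {φ : H ⊗ A ⟶ A} {ϕ : H ⊗ A ⟶ H} [Laws A₁] [Laws A₂] [Laws H₂]

lemma pair_mul_bicrossed (a b c : T ⟶ A) (h g k : T ⟶ H) [IsComonHom h] [IsComonHom b]
    [IsComonHom c] [Commutes h b] [Commutes h c] [Commutes b c] [Commutes g c] :
    pair (pair a h) (pair (pair b g) (pair c k) ≫ (A₁.tensor H₁).mul) ≫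
        (A₂.bicrossed H₂ φ ϕ).mul =
      pair (pair a (pair h (pair b c ≫ A₁.mul) ≫ φ) ≫ A₂.mul)
        (pair (pair h (pair b c ≫ A₁.mul) ≫ ϕ) (pair g k ≫ H₁.mul) ≫ H₂.mul) := by
  rw [pair_tensor_mul, IsMatchedPair.pair_bicrossed_mul]

/-- The `A`-component of `gamma` is that of the brace `A` at `(a, h ▷ c)`, so the brace identity of
`A` collects the `A`-component into `a ·₂ (…)`. The copies of `h` in the antipode and in the actions
must be exchanged, whence `Commutes h h`. -/
lemma pair_bicrossed_gamma [Laws H₁] (hA : IsBraceCompatible A₁ A₂) (a b c : T ⟶ A) (h g k : T ⟶ H)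
    [IsComonHom a] [IsComonHom h] [IsComonHom b] [IsComonHom c] [Commutes h h] [Commutes a h]
    [Commutes a b] [Commutes a g] [Commutes h b] [Commutes h c] [Commutes h g]
    [Commutes b c] [Commutes g c] :
    pair (pair (pair a h) (pair b g) ≫ (A₂.bicrossed H₂ φ ϕ).mul)
        (pair (pair a h) (pair c k) ≫ gamma (A₁.tensor H₁) (A₂.bicrossed H₂ φ ϕ)) ≫
        (A₁.tensor H₁).mul =
      pair (pair a (pair (pair h b ≫ φ) (pair h c ≫ φ) ≫ A₁.mul) ≫ A₂.mul)
        (pair (pair (pair h b ≫ ϕ) g ≫ H₂.mul)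
          (pair (h ≫ H₁.antipode) (pair (pair h c ≫ ϕ) k ≫ H₂.mul) ≫ H₁.mul) ≫ H₁.mul) := by
  rw [pair_gamma, pair_tensor_antipode, IsMatchedPair.pair_bicrossed_mul,
    IsMatchedPair.pair_bicrossed_mul, pair_tensor_mul, pair_tensor_mul, hA.pair_mul, pair_gamma]

lemma isBraceCompatible_bicrossed_iff [Laws H₁] (hH : H₁.IsCocommutative)
    (hA : IsBraceCompatible A₁ A₂) (hm : IsMatchedPair A₂ H₂ φ ϕ) :
    IsBraceCompatible (A₁.tensor H₁) (A₂.bicrossed H₂ φ ϕ) ↔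
      ConditionE1 A₁ H₁ φ ∧ ConditionE2 A₁ H₁ H₂ ϕ := by
  have := hm.isComonHom_left
  have := hm.isComonHom_right
  constructor
  · intro hX
    have key : ∀ {T : C} [ComonObj T] (h g k : T ⟶ H) (b c : T ⟶ A) [IsComonHom h]
        [IsComonHom g] [IsComonHom k] [IsComonHom b] [IsComonHom c] [Commutes h b] [Commutes h g]
        [Commutes h c] [Commutes b g] [Commutes b c] [Commutes g c] [Commutes g k],
        pair (pair h b ≫ φ) (pair h c ≫ φ) ≫ A₁.mul = pair h (pair b c ≫ A₁.mul) ≫ φ ∧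
        pair (pair (pair h b ≫ ϕ) g ≫ H₂.mul)
          (pair (h ≫ H₁.antipode) (pair (pair h c ≫ ϕ) k ≫ H₂.mul) ≫ H₁.mul) ≫ H₁.mul =
        pair (pair h (pair b c ≫ A₁.mul) ≫ ϕ) (pair g k ≫ H₁.mul) ≫ H₂.mul := by
      intro T _ h g k b c _ _ _ _ _ _ _ _ _ _ _ _
      have := hH.commutes_self h
      -- With `a = 1` the outer `A₂`-product disappears, leaving the sides of (E1) and (E2) as
      -- components.
      have e := hX.pair_mul (pair (ε[T] ≫ A₂.one) h) (pair b g) (pair c k)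
      rw [pair_mul_bicrossed, pair_bicrossed_gamma hA, pair_one_left_mul, pair_one_left_mul] at e
      have e₁ := congrArg (· ≫ proj₁ A H) e
      have e₂ := congrArg (· ≫ proj₂ A H) e
      -- A projection returns its component once the discarded one preserves the counit. The
      -- antipode is not available as a comonoid morphism, but counit preservation suffices.
      have hS : (h ≫ H₁.antipode) ≫ ε[H] = ε[T] := by
        rw [Category.assoc, Laws.antipode_counit, IsComonHom.hom_counit]
      have hL : (pair (pair h (pair b c ≫ A₁.mul) ≫ ϕ) (pair g k ≫ H₁.mul) ≫ H₂.mul) ≫ ε[H] =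
          ε[T] :=
        pair_mul_counit _ _ _ (IsComonHom.hom_counit _)
          (pair_mul_counit _ _ _ (IsComonHom.hom_counit _) (IsComonHom.hom_counit _))
      have hR : (pair (pair (pair h b ≫ ϕ) g ≫ H₂.mul)
          (pair (h ≫ H₁.antipode) (pair (pair h c ≫ ϕ) k ≫ H₂.mul) ≫ H₁.mul) ≫ H₁.mul) ≫ ε[H] =
          ε[T] :=
        pair_mul_counit _ _ _
          (pair_mul_counit _ _ _ (IsComonHom.hom_counit _) (IsComonHom.hom_counit _))
          (pair_mul_counit _ _ _ hS
            (pair_mul_counit _ _ _ (IsComonHom.hom_counit _) (IsComonHom.hom_counit _)))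
      simp only [pair_proj₁ _ _ hL, pair_proj₁ _ _ hR] at e₁
      rw [pair_proj₂ _ _ (IsComonHom.hom_counit _), pair_proj₂ _ _
        (pair_mul_counit _ _ _ (IsComonHom.hom_counit _) (IsComonHom.hom_counit _))] at e₂
      exact ⟨e₁.symm, e₂.symm⟩
    -- (E1) does not involve `g` and `k`, so both are set to `1`.
    exact ⟨ConditionE1.of_elements fun h b c _ _ _ _ _ _ ↦
        (key h (ε ≫ H₂.one) (ε ≫ H₂.one) b c).1,
      ConditionE2.of_elements fun h g k b c _ _ _ _ _ _ _ _ _ _ _ _ _ _ _ ↦ (key h g k b c).2⟩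
  · rintro ⟨hE₁, hE₂⟩
    refine IsBraceCompatible.of_elements fun x y z _ _ _ _ _ _ ↦ ?_
    have := hH.commutes_self (x ≫ proj₂ A H)
    rw [← pair_comp_projections x, ← pair_comp_projections y, ← pair_comp_projections z,
      pair_mul_bicrossed, pair_bicrossed_gamma hA, hE₁.pair_act_mul, hE₂.pair_mul]

end Bicrossed

end Brace

end HopfTuple

theorem theorem2p3 {C : Type u} [Category.{v} C] [MonoidalCategory C] [SymmetricCategory C]
    {A H : C} (A₁ A₂ : HopfTuple A) (H₁ H₂ : HopfTuple H)
    (hA : HopfTuple.IsHopfBrace A₁ A₂)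
    (hH : HopfTuple.IsCocommutativeHopfBrace H₁ H₂)
    (φ : H ⊗ A ⟶ A) (ϕ : H ⊗ A ⟶ H)
    (hm : HopfTuple.IsMatchedPair A₂ H₂ φ ϕ) :
    HopfTuple.IsHopfBrace (A₁.tensor H₁) (A₂.bicrossed H₂ φ ϕ) ↔
      HopfTuple.ConditionE1 A₁ H₁ φ ∧ HopfTuple.ConditionE2 A₁ H₁ H₂ ϕ := by
  -- The coalgebra of the first Hopf algebra of each brace is fixed as the common comonoid
  -- structure.
  obtain ⟨cA, hcA⟩ : ∃ c : ComonObj A, A₁.comul = c.comul ∧ A₁.counit = c.counit := by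
    obtain ⟨j, hj⟩ := hA.isHopfAlgebra₁
    exact ⟨j.toComonObj, by rw [← hj]; exact ⟨rfl, rfl⟩⟩
  obtain ⟨cH, hcH⟩ : ∃ c : ComonObj H, H₁.comul = c.comul ∧ H₁.counit = c.counit := by
    obtain ⟨j, hj⟩ := hH.isHopfAlgebra₁
    exact ⟨j.toComonObj, by rw [← hj]; exact ⟨rfl, rfl⟩⟩
  have : HopfTuple.Laws A₁ := .of_isHopfAlgebra hA.isHopfAlgebra₁ hcA.1 hcA.2
  have : HopfTuple.Laws A₂ := .of_isHopfAlgebra hA.isHopfAlgebra₂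
    (hA.comul_eq.symm.trans hcA.1) (hA.counit_eq.symm.trans hcA.2)
  have : HopfTuple.Laws H₁ := .of_isHopfAlgebra hH.isHopfAlgebra₁ hcH.1 hcH.2
  have : HopfTuple.Laws H₂ := .of_isHopfAlgebra hH.isHopfAlgebra₂
    (hH.comul_eq.symm.trans hcH.1) (hH.counit_eq.symm.trans hcH.2)
  -- Both tuples are Hopf algebras with the same coalgebra unconditionally, so only the
  -- compatibility is at stake.
  have := hm.laws_bicrossed
  rw [← HopfTuple.isBraceCompatible_bicrossed_iff hH.cocomm hA.compat hm]
  refine ⟨fun h ↦ h.compat, fun h ↦ ⟨HopfTuple.Laws.isHopfAlgebra _,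
    HopfTuple.Laws.isHopfAlgebra _, ?_, ?_, h⟩⟩
  · rw [HopfTuple.Laws.counit_eq, HopfTuple.Laws.counit_eq]
  · rw [HopfTuple.Laws.comul_eq, HopfTuple.Laws.comul_eq]
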